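/- Let $\{p_k\}_{k\ge 0}$ be a probability distribution on $\mathbb{N}=\{0,1,2,\dots\}$ with $p_0=0$. Consider the branching random walk on $\mathbb{R}$ with offspring law $\{p_k\}$ and standard normal steps: it starts from one particle at the origin at time $0$; at each time step every particle dies and produces a random number of children with law $\{p_k\}$, and each child is displaced from the position of its parent by a standard normal random variable, all offspring numbers and all displacements being independent. For $A\subset\mathbb{R}$ let $Z_n(A)$ be the number of particles of generation $n$ located in $A$, let $|Z_1|=Z_1(\mathbb{R})$ (a random variable with law $\{p_k\}$), and let $m=\mathbb{E}|Z_1|=\sum_k k\,p_k$. Assume that for some $\beta>1$ $$0<\liminf_{y\to+\infty} y^{\beta}\,\mathbb{P}(|Z_1|>y)\le\limsup_{y\to+\infty} y^{\beta}\,\mathbb{P}(|Z_1|>y)<\infty$$ (so that $1<m<\infty$). Let $x>0$ and $a>\max\left(\log m-\frac{x^2}{2},\,0\right)$. Then $$-\left[(\beta-1)a+a-\left(\log m-\frac{x^2}{2}\right)\right]\le\liminf_{n\to\infty}\frac1n\log\mathbb{P}\big(Z_n([xn,\infty))\ge e^{an}\big)\le\limsup_{n\to\infty}\frac1n\log\mathbb{P}\big(Z_n([xn,\infty))\ge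 e^{an}\big)\le-\left[a-\left(\log m-\frac{x^2}{2}\right)\right].$$ -/

import Mathlib

open MeasureTheory ProbabilityTheory Filter Asymptotics

namespace BRW

/-- Particles carry Ulam-Harris labels: the root is `[]` and the children of `u` are
`0 :: u, 1 :: u, …`. If the particle `u` has `N u` children, then `generation N n` is the finite
set of labels of the particles alive at time `n`. -/
def generation (N : List ℕ → ℕ) : ℕ → Finset (List ℕ)
  | 0 => {[]}
  | n + 1 => (generation N n).biUnion fun u => (Finset.range (N u)).image fun i => i :: u

/-- The position of a particle: the root sits at the origin, and the particle `v` is displaced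
by `X v` from the position of its parent. -/
def position (X : List ℕ → ℝ) : List ℕ → ℝ
  | [] => 0
  | i :: u => position X u + X (i :: u)

open Classical in
/-- `Z_n(A)`: the number of particles of generation `n` that are located in `A`. -/
noncomputable def count (N : List ℕ → ℕ) (X : List ℕ → ℝ) (n : ℕ) (A : Set ℝ) : ℕ :=
  ((generation N n).filter fun u => position X u ∈ A).card

/-- The mean `m` of the offspring law `p`. -/
noncomputable def offspringMean (p : PMF ℕ) : ℝ := ∫ k, (k : ℝ) ∂p.toMeasure

/-- The families `N` (numbers of children) and `X` (displacements), indexed by the Ulam-Harris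
labels, drive a branching random walk with offspring law `p` and step law `ν`: all the random
variables `N u` and `X u` together are independent, each `N u` has law `p`, and each `X u` has
law `ν`. -/
structure IsBranchingRandomWalk {Ω : Type*} [MeasurableSpace Ω] (P : Measure Ω)
    (p : PMF ℕ) (ν : Measure ℝ) (N : List ℕ → Ω → ℕ) (X : List ℕ → Ω → ℝ) : Prop where
  measurable_offspring : ∀ u, Measurable (N u)
  measurable_step : ∀ u, Measurable (X u)
  law_offspring : ∀ u, P.map (N u) = p.toMeasure
  law_step : ∀ u, P.map (X u) = ν
  indep_offspring_step : ∀ u, IndepFun (N u) (X u) P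
  indep_particles : iIndepFun (fun u ω => (N u ω, X u ω)) P

/-- `P(Z_n([xn, ∞)) ≥ e^{an})`. -/
noncomputable def levelProb {Ω : Type*} [MeasurableSpace Ω] (P : Measure Ω)
    (N : List ℕ → Ω → ℕ) (X : List ℕ → Ω → ℝ) (x a : ℝ) (n : ℕ) : ENNReal :=
  P {ω | Real.exp (a * n) ≤
    (count (fun u => N u ω) (fun u => X u ω) n (Set.Ici (x * n)) : ℝ)}

/-- `(1/n) log P(Z_n([xn, ∞)) ≥ e^{an})`, an extended real number; the logarithm of `0`
is `-∞`. -/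
noncomputable def logRate {Ω : Type*} [MeasurableSpace Ω] (P : Measure Ω)
    (N : List ℕ → Ω → ℕ) (X : List ℕ → Ω → ℝ) (x a : ℝ) (n : ℕ) : EReal :=
  ((1 / (n : ℝ) : ℝ) : EReal) * ENNReal.log (levelProb P N X x a n)

end BRW

/-! Write λ = log m - x²/2; the expected number of particles beyond xn at time n is e^{λn} to
exponential order.

Upper bound: exponential tilting at parameter x gives E Z_n([y,∞)) ≤ e^{-xy} (m e^{x²/2})^n
(`lintegral_count_le`). At y = xn this is e^{λn}, and Markov's inequality concludes.

Lower bound: one particle alive just before time n, near the line of slope x, has about e^{an}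
children, a constant fraction of which jump beyond x. A given particle does this with probability of
order e^{-βan}, by the regularity of the offspring tail, and some particle does it with probability
about e^{λn} e^{-βan}.

No second moment is needed. With K = e^{an} fixed, let s_n(y) = P(Z_n([y,∞)) ≥ K). Since one child
with K descendants suffices, decomposing at the root bounds s_{n+1} below by E[1 - (1 - s)^{|Z_1|}],
where s is the Gaussian average of s_n. For s ≤ δ this is at least m' s, for any fixed m' < m
(`exists_linear_lower_bound`). The recursion starts from s_1 ≥ q of order e^{-βan} on y ≤ x
(`isTailBound_one`) and is run over blocks of l generations, each gaining a factor close to e^{λl}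
while the threshold moves by xl. As βa > max(0, λ), the propagated lower bounds stay below δ
throughout. -/

namespace BRW

/-! ### Decomposition of the tree at the root, and measurability -/

/-- The subtree of descendants of the child `i` of the root. -/
def subtree {α : Type*} (f : List ℕ → α) (i : ℕ) : List ℕ → α := fun v => f (v ++ [i])

/-- The definition grows the tree at its leaves, whereas every recursion below conditions on the
root. Labels list the most recent ancestor first, so the child of the root is the last entry. -/
lemma generation_succ_root (N : List ℕ → ℕ) (n : ℕ) :
    generation N (n + 1) = (Finset.range (N [])).biUnion fun i =>
      (generation (subtree N i) n).image (· ++ [i]) := by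
  induction n with
  | zero => ext v; simp [generation, eq_comm]
  | succ n ih =>
    rw [generation, ih]
    ext v
    simp only [Finset.mem_biUnion, Finset.mem_image, Finset.mem_range, generation]
    constructor
    · rintro ⟨_, ⟨i, hi, u, hu, rfl⟩, j, hj, rfl⟩
      exact ⟨i, hi, j :: u, ⟨u, hu, j, hj, rfl⟩, rfl⟩
    · rintro ⟨i, hi, _, ⟨u, hu, j, hj, rfl⟩, rfl⟩
      exact ⟨u ++ [i], ⟨i, hi, u, hu, rfl⟩, j, hj, rfl⟩

lemma position_append_singleton (X : List ℕ → ℝ) (v : List ℕ) (i : ℕ) :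
    position X (v ++ [i]) = X [i] + position (subtree X i) v := by
  induction v with
  | nil => simp [position]
  | cons j v ih => simp [position, ih, subtree, add_assoc]

lemma count_zero (N : List ℕ → ℕ) (X : List ℕ → ℝ) (y : ℝ) :
    count N X 0 (Set.Ici y) = if y ≤ 0 then 1 else 0 := by
  rw [count, generation, Finset.filter_singleton]
  by_cases h : y ≤ 0
  · rw [if_pos (by simpa [position] using h), if_pos h, Finset.card_singleton]
  · rw [if_neg (by simpa [position] using h), if_neg h, Finset.card_empty]

lemma count_succ_root (N : List ℕ → ℕ) (X : List ℕ → ℝ) (n : ℕ) (y : ℝ) :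
    count N X (n + 1) (Set.Ici y) = ∑ i ∈ Finset.range (N []),
      count (subtree N i) (subtree X i) n (Set.Ici (y - X [i])) := by
  classical
  rw [count, generation_succ_root, Finset.filter_biUnion, Finset.card_biUnion]
  · refine Finset.sum_congr rfl fun i _ => ?_
    rw [count, Finset.filter_image, Finset.card_image_of_injective _ (List.append_left_injective _)]
    congr 1
    ext v
    simp [position_append_singleton, add_comm]
  · intro i _ j _ hij
    rw [Function.onFun, Finset.disjoint_left]
    intro v hv hv'
    simp only [Finset.mem_filter, Finset.mem_image] at hv hv'
    obtain ⟨⟨u, -, rfl⟩, -⟩ := hv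
    obtain ⟨⟨u', -, h⟩, -⟩ := hv'
    exact hij (by simpa using (List.append_inj_right' h rfl).symm)

lemma position_congr {X Y : List ℕ → ℝ} (h : ∀ u, u ≠ [] → X u = Y u) (u : List ℕ) :
    position X u = position Y u := by
  induction u with
  | nil => rfl
  | cons i u ih => simp [position, ih, h (i :: u)]

lemma count_congr (N : List ℕ → ℕ) {X Y : List ℕ → ℝ} (h : ∀ u, u ≠ [] → X u = Y u) (n : ℕ)
    (A : Set ℝ) : count N X n A = count N Y n A := by
  rw [count, count, funext (position_congr h)]

lemma measurable_sum_range {α : Type*} [MeasurableSpace α] {T : α → ℕ} {g : ℕ → α → ℕ}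
    (hT : Measurable T) (hg : ∀ i, Measurable (g i)) :
    Measurable fun a => ∑ i ∈ Finset.range (T a), g i a := by
  have key : Measurable fun r : ℕ × α => ∑ i ∈ Finset.range r.1, g i r.2 :=
    measurable_from_prod_countable_right fun k =>
      Finset.measurable_fun_sum (Finset.range k) fun i _ => hg i
  exact key.comp (hT.prodMk measurable_id)

/-- Joint measurability in the families and the threshold is needed because the root decomposition
makes the threshold `y - X [i]` random. -/
lemma measurable_count (n : ℕ) :
    Measurable fun q : (List ℕ → ℕ × ℝ) × ℝ =>
      count (fun u => (q.1 u).1) (fun u => (q.1 u).2) n (Set.Ici q.2) := by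
  induction n with
  | zero =>
    simp only [count_zero]
    exact Measurable.ite (measurableSet_le measurable_snd measurable_const)
      measurable_const measurable_const
  | succ n ih =>
    simp only [count_succ_root]
    refine measurable_sum_range (by fun_prop) fun i => ?_
    have : Measurable fun q : (List ℕ → ℕ × ℝ) × ℝ =>
        ((fun v => q.1 (v ++ [i]), q.2 - (q.1 [i]).2) : (List ℕ → ℕ × ℝ) × ℝ) := by
      fun_prop
    exact ih.comp this

/-! ### Independence of the particles -/

/-- The information carried by the particles in `S`. -/
abbrev particleSigma {Ω : Type*} (N : List ℕ → Ω → ℕ) (X : List ℕ → Ω → ℝ) (S : Set (List ℕ)) :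
    MeasurableSpace Ω :=
  ⨆ u ∈ S, MeasurableSpace.comap (fun ω => (N u ω, X u ω)) inferInstance

lemma measurable_particleSigma {Ω : Type*} (N : List ℕ → Ω → ℕ) (X : List ℕ → Ω → ℝ) {S : Set (List ℕ)}
    {u : List ℕ} (hu : u ∈ S) :
    Measurable[particleSigma N X S] fun ω => (N u ω, X u ω) :=
  Measurable.of_comap_le (le_iSup₂ (f := fun u (_ : u ∈ S) =>
    MeasurableSpace.comap (fun ω => (N u ω, X u ω)) inferInstance) u hu)

lemma measurable_particleSigma_count_subtree
    {Ω : Type*} (N : List ℕ → Ω → ℕ) (X : List ℕ → Ω → ℝ) {S : Set (List ℕ)}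
    {i : ℕ} (hS : ∀ v, v ++ [i] ∈ S) (n : ℕ) (y : ℝ) :
    Measurable[particleSigma N X S] fun ω =>
      count (fun u => subtree N i u ω) (fun u => subtree X i u ω) n
        (Set.Ici (y - X [i] ω)) := by
  let _ : MeasurableSpace Ω := particleSigma N X S
  have h1 : ∀ v, Measurable fun ω => (N (v ++ [i]) ω, X (v ++ [i]) ω) :=
    fun v => measurable_particleSigma N X (hS v)
  have : Measurable fun ω => ((fun v => (N (v ++ [i]) ω, X (v ++ [i]) ω), y - X [i] ω) :
      (List ℕ → ℕ × ℝ) × ℝ) :=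
    (measurable_pi_iff.2 h1).prodMk (measurable_const.sub (h1 []).snd)
  exact (measurable_count n).comp this

lemma measurable_particleSigma_pi {Ω : Type*} (N : List ℕ → Ω → ℕ) (X : List ℕ → Ω → ℝ)
    (S : Set (List ℕ)) :
    Measurable[particleSigma N X S] fun ω (u : S) => (N u ω, X u ω) := by
  let _ : MeasurableSpace Ω := particleSigma N X S
  exact measurable_pi_iff.2 fun u => measurable_particleSigma N X u.2

variable {Ω : Type*} [MeasurableSpace Ω] {P : Measure Ω} {p : PMF ℕ} {ν : Measure ℝ}
  {N : List ℕ → Ω → ℕ} {X : List ℕ → Ω → ℝ}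

lemma IsBranchingRandomWalk.subtree (h : IsBranchingRandomWalk P p ν N X) (i : ℕ) :
    IsBranchingRandomWalk P p ν (subtree N i) (subtree X i) where
  measurable_offspring _ := h.measurable_offspring _
  measurable_step _ := h.measurable_step _
  law_offspring _ := h.law_offspring _
  law_step _ := h.law_step _
  indep_offspring_step _ := h.indep_offspring_step _
  indep_particles := h.indep_particles.precomp (List.append_left_injective [i])

lemma IsBranchingRandomWalk.measurable_particle (h : IsBranchingRandomWalk P p ν N X)
    (u : List ℕ) : Measurable fun ω => (N u ω, X u ω) :=
  (h.measurable_offspring u).prodMk (h.measurable_step u)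

lemma IsBranchingRandomWalk.indep_particleSigma (h : IsBranchingRandomWalk P p ν N X)
    {S T : Set (List ℕ)} (hST : Disjoint S T) :
    Indep (particleSigma N X S) (particleSigma N X T) P :=
  indep_iSup_of_disjoint (fun u => (h.measurable_particle u).comap_le) h.indep_particles hST

lemma IsBranchingRandomWalk.measurable_count_subtree (h : IsBranchingRandomWalk P p ν N X)
    (i n : ℕ) (y : ℝ) :
    Measurable fun ω => count (fun u => BRW.subtree N i u ω) (fun u => BRW.subtree X i u ω) n
        (Set.Ici (y - X [i] ω)) :=
  (measurable_particleSigma_count_subtree N X (S := Set.univ) (by simp) n y).mono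
    (iSup₂_le fun u _ => (h.measurable_particle u).comap_le) le_rfl

/-- The root's step enters no position, so in a subtree it is free to play the displacement of the
child that carries the subtree. Independence is checked on rectangles, combining that of `N []` and
`X []` with that of the root and the rest. The value 0 replaces `X []` to keep a family indexed by
all labels. -/
lemma IsBranchingRandomWalk.indepFun_root_step [IsProbabilityMeasure P]
    (h : IsBranchingRandomWalk P p ν N X) :
    IndepFun (X []) (fun ω (u : List ℕ) => (N u ω, if u = [] then 0 else X u ω)) P := by
  have hN := h.measurable_offspring []
  have hX := h.measurable_step []
  have hmR : Measurable fun ω (u : {u : List ℕ // u ≠ []}) => (N u ω, X u ω) :=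
    measurable_pi_iff.2 fun u => h.measurable_particle u
  have hR : IndepFun (fun ω => (N [] ω, X [] ω))
      (fun ω (u : {u : List ℕ // u ≠ []}) => (N u ω, X u ω)) P := by
    rw [IndepFun_iff_Indep]
    refine indep_of_indep_of_le (h.indep_particleSigma (S := {[]}) (T := {u | u ≠ []}) ?_)
      (Measurable.comap_le (measurable_particleSigma N X rfl)) ?_
    · simp
    · exact Measurable.comap_le (measurable_particleSigma_pi N X {u | u ≠ []})
  have key : IndepFun (X [])
      (fun ω => (N [] ω, fun (u : {u : List ℕ // u ≠ []}) => (N u ω, X u ω))) P := by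
    rw [IndepFun_iff_Indep]
    have hpi : MeasurableSpace.comap (fun ω => (N [] ω,
        fun (u : {u : List ℕ // u ≠ []}) => (N u ω, X u ω))) inferInstance =
        MeasurableSpace.generateFrom (Set.preimage (fun ω => (N [] ω,
          fun (u : {u : List ℕ // u ≠ []}) => (N u ω, X u ω))) ''
          (Set.image2 (· ×ˢ ·) {s | MeasurableSet s} {t | MeasurableSet t})) := by
      rw [← MeasurableSpace.comap_generateFrom, generateFrom_prod]
    refine IndepSets.indep hX.comap_le (hN.prodMk hmR).comap_le
      (@MeasurableSpace.isPiSystem_measurableSet _ (MeasurableSpace.comap (X []) inferInstance))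
      (isPiSystem_prod.comap _) (@MeasurableSpace.generateFrom_measurableSet _
        (MeasurableSpace.comap (X []) inferInstance)).symm hpi ?_
    rw [IndepSets_iff]
    rintro _ _ ⟨A, hA, rfl⟩ ⟨_, ⟨B, hB, C, hC, rfl⟩, rfl⟩
    rw [Set.mem_ofPred_eq] at hB hC
    have e1 := hR.measure_inter_preimage_eq_mul _ C (hB.prod hA) hC
    have e2 := hR.measure_inter_preimage_eq_mul _ C (hB.prod MeasurableSet.univ) hC
    have e3 := (h.indep_offspring_step []).measure_inter_preimage_eq_mul B A hB hA
    simp only [Set.mk_preimage_prod, Set.preimage_univ, Set.inter_univ] at e1 e2 ⊢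
    rw [e2, ← mul_assoc, mul_comm (P (X [] ⁻¹' A)), ← e3, ← e1, ← Set.inter_assoc,
      Set.inter_comm (X [] ⁻¹' A)]
  have hg : Measurable fun (q : ℕ × ({u : List ℕ // u ≠ []} → ℕ × ℝ)) (u : List ℕ) =>
      if hu : u = [] then (q.1, (0 : ℝ)) else q.2 ⟨u, hu⟩ := by
    refine measurable_pi_iff.2 fun u => ?_
    split_ifs <;> fun_prop
  convert key.comp measurable_id hg using 1
  · rfl
  · funext ω u
    rcases eq_or_ne u [] with rfl | hu
    · simp
    · simp [hu]

/-- Averaging a functional of the tail counts, started from the position of the root, over the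
step of the root. -/
lemma IsBranchingRandomWalk.lintegral_count_sub_step [IsProbabilityMeasure P] [SFinite ν]
    (h : IsBranchingRandomWalk P p ν N X) (f : ℕ → ENNReal) (n : ℕ) (y : ℝ) :
    ∫⁻ ω, f (count (fun u => N u ω) (fun u => X u ω) n (Set.Ici (y - X [] ω))) ∂P =
      ∫⁻ z, ∫⁻ ω, f (count (fun u => N u ω) (fun u => X u ω) n (Set.Ici (y - z))) ∂P ∂ν := by
  have hw : Measurable fun ω (u : List ℕ) => (N u ω, if u = [] then 0 else X u ω) := by
    refine measurable_pi_iff.2 fun u => (h.measurable_offspring u).prodMk ?_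
    split_ifs
    · exact measurable_const
    · exact h.measurable_step u
  have hcount : ∀ ω y, count (fun u => N u ω) (fun u => X u ω) n (Set.Ici y) =
      count (fun u => N u ω) (fun u => if u = [] then 0 else X u ω) n (Set.Ici y) :=
    fun ω y => count_congr _ (fun u hu => by simp [hu]) _ _
  have hF : Measurable fun q : ℝ × (List ℕ → ℕ × ℝ) =>
      f (count (fun u => (q.2 u).1) (fun u => (q.2 u).2) n (Set.Ici (y - q.1))) := by
    have : Measurable fun q : ℝ × (List ℕ → ℕ × ℝ) => (q.2, y - q.1) := by fun_prop
    exact measurable_from_nat.comp ((measurable_count n).comp this)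
  simp only [hcount]
  have e := (indepFun_iff_map_prod_eq_prod_map_map (h.measurable_step []).aemeasurable
    hw.aemeasurable).1 h.indepFun_root_step
  calc _ = ∫⁻ q, f (count (fun u => (q.2 u).1) (fun u => (q.2 u).2) n (Set.Ici (y - q.1)))
        ∂(P.map fun ω => (X [] ω, fun u : List ℕ => (N u ω, if u = [] then 0 else X u ω))) := by
        rw [lintegral_map hF ((h.measurable_step []).prodMk hw)]
    _ = _ := by
        rw [e, h.law_step, lintegral_prod _ hF.aemeasurable]
        refine lintegral_congr fun z => ?_
        rw [lintegral_map (by exact hF.comp measurable_prodMk_left) hw]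

end BRW

/-! ### First moment, and the recursion at the root -/

namespace BRW

variable {Ω : Type*} [MeasurableSpace Ω] {P : Measure Ω} {p : PMF ℕ} {ν : Measure ℝ}
  {N : List ℕ → Ω → ℕ} {X : List ℕ → Ω → ℝ}

lemma IsBranchingRandomWalk.indep_root_children (h : IsBranchingRandomWalk P p ν N X) :
    Indep (particleSigma N X {[]}) (particleSigma N X {u | u ≠ []}) P :=
  h.indep_particleSigma (by simp)

lemma measurable_particleSigma_root {Ω : Type*} (N : List ℕ → Ω → ℕ) (X : List ℕ → Ω → ℝ) :
    Measurable[particleSigma N X {[]}] (N []) := by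
  let _ : MeasurableSpace Ω := particleSigma N X {[]}
  exact (measurable_particleSigma N X (Set.mem_singleton [])).fst

lemma IsBranchingRandomWalk.indepFun_root_count_subtree (h : IsBranchingRandomWalk P p ν N X)
    (i n : ℕ) (y : ℝ) :
    IndepFun (N []) (fun ω => count (fun u => BRW.subtree N i u ω)
      (fun u => BRW.subtree X i u ω) n (Set.Ici (y - X [i] ω))) P := by
  rw [IndepFun_iff_Indep]
  exact indep_of_indep_of_le h.indep_root_children
    (measurable_particleSigma_root N X).comap_le
    (measurable_particleSigma_count_subtree N X (by simp) n y).comap_le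

lemma natCast_eq_tsum_ite (k : ℕ) : (k : ENNReal) = ∑' i : ℕ, if i < k then 1 else 0 := by
  rw [tsum_eq_sum (s := Finset.range k) (by simp), Finset.sum_ite_of_true (by simp)]
  simp

/-- The first-moment bound for the number of particles in a half-line. -/
lemma IsBranchingRandomWalk.lintegral_count_le [IsProbabilityMeasure P] [SFinite ν]
    {x : ℝ} (hx : 0 ≤ x) {L : ENNReal} (hL : ∫⁻ z, ENNReal.ofReal (Real.exp (x * z)) ∂ν ≤ L)
    (n : ℕ) :
    ∀ {N : List ℕ → Ω → ℕ} {X : List ℕ → Ω → ℝ}, IsBranchingRandomWalk P p ν N X → ∀ y : ℝ,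
    ∫⁻ ω, (count (fun u => N u ω) (fun u => X u ω) n (Set.Ici y) : ENNReal) ∂P ≤
      ENNReal.ofReal (Real.exp (-(x * y))) * ((∫⁻ k, (k : ENNReal) ∂p.toMeasure) * L) ^ n := by
  induction n with
  | zero =>
    intro N X h y
    simp only [count_zero, lintegral_const, measure_univ, mul_one, pow_zero]
    split_ifs with hy
    · rw [Nat.cast_one, ENNReal.one_le_ofReal, Real.one_le_exp_iff]
      nlinarith
    · simp
  | succ n ih =>
    intro N X h y
    set μ := ∫⁻ k, (k : ENNReal) ∂p.toMeasure
    have hC : ∀ i, ∫⁻ ω, (count (fun u => BRW.subtree N i u ω) (fun u => BRW.subtree X i u ω) n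
        (Set.Ici (y - X [i] ω)) : ENNReal) ∂P ≤
        ENNReal.ofReal (Real.exp (-(x * y))) * (μ * L) ^ n * L := by
      intro i
      -- The child's displacement is the unused root step of its own subtree, so it merely averages
      -- the threshold.
      rw [show X [i] = BRW.subtree X i [] from rfl,
        (h.subtree i).lintegral_count_sub_step (fun k => (k : ENNReal))]
      calc _ ≤ ∫⁻ z, ENNReal.ofReal (Real.exp (-(x * (y - z)))) * (μ * L) ^ n ∂ν :=
            lintegral_mono fun z => ih (h.subtree i) (y - z)
        _ = ∫⁻ z, (ENNReal.ofReal (Real.exp (-(x * y))) * (μ * L) ^ n) *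
              ENNReal.ofReal (Real.exp (x * z)) ∂ν := by
            refine lintegral_congr fun z => ?_
            rw [show -(x * (y - z)) = -(x * y) + x * z by ring, Real.exp_add,
              ENNReal.ofReal_mul (Real.exp_pos _).le]
            ring
        _ ≤ _ := by
            rw [lintegral_const_mul _ (by fun_prop)]
            gcongr
    have hmeas : ∀ i, Measurable fun k : ℕ => if i < k then (1 : ENNReal) else 0 :=
      fun i => measurable_from_nat
    -- A series with indicators `i < N []` replaces the random number of summands, so that each term
    -- is a product of independent factors.
    calc ∫⁻ ω, (count (fun u => N u ω) (fun u => X u ω) (n + 1) (Set.Ici y) : ENNReal) ∂P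
        = ∫⁻ ω, ∑' i : ℕ, (if i < N [] ω then 1 else 0) *
          (count (fun u => BRW.subtree N i u ω) (fun u => BRW.subtree X i u ω) n
            (Set.Ici (y - X [i] ω)) : ENNReal) ∂P := by
          refine lintegral_congr fun ω => ?_
          rw [count_succ_root, tsum_eq_sum (s := Finset.range (N [] ω)) (by
            intro i hi; rw [if_neg (by simpa using hi), zero_mul]), Nat.cast_sum]
          refine Finset.sum_congr rfl fun i hi => ?_
          rw [if_pos (by simpa using hi), one_mul]
          rfl
      _ = ∑' i : ℕ, (∫⁻ ω, (if i < N [] ω then 1 else 0) ∂P) *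
          ∫⁻ ω, (count (fun u => BRW.subtree N i u ω) (fun u => BRW.subtree X i u ω) n
            (Set.Ici (y - X [i] ω)) : ENNReal) ∂P := by
          rw [lintegral_tsum]
          · refine tsum_congr fun i => ?_
            exact lintegral_mul_eq_lintegral_mul_lintegral_of_indepFun
              ((hmeas i).comp (h.measurable_offspring []))
              (measurable_from_nat.comp (h.measurable_count_subtree i n y))
              ((h.indepFun_root_count_subtree i n y).comp (hmeas i) measurable_from_nat)
          · intro i
            exact (((hmeas i).comp (h.measurable_offspring [])).mul
              (measurable_from_nat.comp (h.measurable_count_subtree i n y))).aemeasurable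
      _ ≤ ∑' i : ℕ, (∫⁻ ω, (if i < N [] ω then 1 else 0) ∂P) *
          (ENNReal.ofReal (Real.exp (-(x * y))) * (μ * L) ^ n * L) :=
          ENNReal.tsum_le_tsum fun i => by gcongr; exact hC i
      _ = μ * (ENNReal.ofReal (Real.exp (-(x * y))) * (μ * L) ^ n * L) := by
          rw [ENNReal.tsum_mul_right, ← lintegral_tsum (f := fun i ω => if i < N [] ω then 1 else 0)
            fun i => ((hmeas i).comp (h.measurable_offspring [])).aemeasurable]
          congr 1
          simp only [← natCast_eq_tsum_ite]
          rw [← lintegral_map (f := fun k : ℕ => (k : ENNReal)) measurable_from_nat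
            (h.measurable_offspring []), h.law_offspring]
      _ = _ := by rw [pow_succ]; ring

/-- If each child succeeds, independently of the others, with probability at least `s`, then the
first `j` children all fail with probability at most `(1 - s) ^ j`. -/
lemma IsBranchingRandomWalk.measureReal_forall_children_lt [IsProbabilityMeasure P]
    (h : IsBranchingRandomWalk P p ν N X) (n : ℕ) (y K : ℝ) {s : ℝ}
    (hs : ∀ i, s ≤ P.real {ω | K ≤ (count (fun u => BRW.subtree N i u ω)
      (fun u => BRW.subtree X i u ω) n (Set.Ici (y - X [i] ω)) : ℝ)}) (j : ℕ) :
    P.real {ω | ∀ i < j, (count (fun u => BRW.subtree N i u ω)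
      (fun u => BRW.subtree X i u ω) n (Set.Ici (y - X [i] ω)) : ℝ) < K} ≤ (1 - s) ^ j := by
  have hs1 : 0 ≤ 1 - s := sub_nonneg.2 ((hs 0).trans measureReal_le_one)
  induction j with
  | zero => simp
  | succ j ih =>
    set C : ℕ → Ω → ℕ := fun i ω => count (fun u => BRW.subtree N i u ω)
      (fun u => BRW.subtree X i u ω) n (Set.Ici (y - X [i] ω)) with hCdef
    have hsplit : {ω | ∀ i < j + 1, (C i ω : ℝ) < K} =
        {ω | ∀ i < j, (C i ω : ℝ) < K} ∩ {ω | (C j ω : ℝ) < K} := by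
      ext ω
      simp only [Set.mem_ofPred_eq, Set.mem_inter_iff, Nat.forall_lt_succ_right]
    have hind : Indep (particleSigma N X {u | ∃ i < j, ∃ v, u = v ++ [i]})
        (particleSigma N X {u | ∃ v, u = v ++ [j]}) P := by
      refine h.indep_particleSigma (Set.disjoint_left.2 ?_)
      rintro _ ⟨i, hi, v, rfl⟩ ⟨w, hw⟩
      have := List.append_inj_right' hw rfl
      simp only [List.cons.injEq, and_true] at this
      omega
    have hm : ∀ (S : Set (List ℕ)) (i : ℕ), (∀ v, v ++ [i] ∈ S) →
        MeasurableSet[particleSigma N X S] {ω | (C i ω : ℝ) < K} := fun S i hS =>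
      measurable_particleSigma_count_subtree N X hS n y
        (MeasurableSet.of_discrete (s := {k : ℕ | (k : ℝ) < K}))
    have hA : MeasurableSet[particleSigma N X {u | ∃ i < j, ∃ v, u = v ++ [i]}]
        {ω | ∀ i < j, (C i ω : ℝ) < K} := by
      have : {ω | ∀ i < j, (C i ω : ℝ) < K} = ⋂ i, ⋂ (_ : i < j), {ω | (C i ω : ℝ) < K} := by
        ext ω; simp
      rw [this]
      exact MeasurableSet.iInter fun i => MeasurableSet.iInter fun hi =>
        hm _ i fun v => ⟨i, hi, v, rfl⟩
    have hB := hm {u | ∃ v, u = v ++ [j]} j fun v => ⟨v, rfl⟩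
    have hB' : P.real {ω | (C j ω : ℝ) < K} ≤ 1 - s := by
      have hmeas : MeasurableSet {ω | K ≤ (C j ω : ℝ)} :=
        h.measurable_count_subtree j n y (MeasurableSet.of_discrete (s := {k : ℕ | K ≤ (k : ℝ)}))
      have : {ω | (C j ω : ℝ) < K} = {ω | K ≤ (C j ω : ℝ)}ᶜ := by ext ω; simp
      rw [this, probReal_compl_eq_one_sub hmeas]
      linarith [hs j]
    rw [hsplit, measureReal_def, (Indep_iff _ _ _).1 hind _ _ hA hB, ENNReal.toReal_mul, pow_succ]
    exact mul_le_mul ih hB' ENNReal.toReal_nonneg (pow_nonneg hs1 _)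

/-- One step of the recursion for the probability of a large tail count. -/
lemma IsBranchingRandomWalk.sum_le_measureReal_level_succ [IsProbabilityMeasure P]
    (h : IsBranchingRandomWalk P p ν N X) (n : ℕ) (y K : ℝ) {s : ℝ}
    (hs : ∀ i, s ≤ P.real {ω | K ≤ (count (fun u => BRW.subtree N i u ω)
      (fun u => BRW.subtree X i u ω) n (Set.Ici (y - X [i] ω)) : ℝ)}) (M : ℕ) :
    ∑ k ∈ Finset.range M, (p k).toReal * (1 - (1 - s) ^ k) ≤
      P.real {ω | K ≤ (count (fun u => N u ω) (fun u => X u ω) (n + 1) (Set.Ici y) : ℝ)} := by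
  set C : ℕ → Ω → ℕ := fun i ω => count (fun u => BRW.subtree N i u ω)
      (fun u => BRW.subtree X i u ω) n (Set.Ici (y - X [i] ω)) with hCdef
  have hC : ∀ i, MeasurableSet[particleSigma N X {u | u ≠ []}] {ω | (C i ω : ℝ) < K} := fun i =>
    measurable_particleSigma_count_subtree N X (by simp) n y
      (MeasurableSet.of_discrete (s := {k : ℕ | (k : ℝ) < K}))
  have hle : particleSigma N X {u | u ≠ []} ≤ (inferInstance : MeasurableSpace Ω) :=
    iSup₂_le fun u _ => (h.measurable_particle u).comap_le
  have hall : ∀ k : ℕ, MeasurableSet[particleSigma N X {u | u ≠ []}]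
      {ω | ∀ i < k, (C i ω : ℝ) < K} := by
    intro k
    have : {ω | ∀ i < k, (C i ω : ℝ) < K} = ⋂ i, ⋂ (_ : i < k), {ω | (C i ω : ℝ) < K} := by
      ext ω; simp
    rw [this]
    exact MeasurableSet.iInter fun i => MeasurableSet.iInter fun _ => hC i
  have hroot : ∀ k, MeasurableSet (N [] ⁻¹' {k}) := fun k =>
    h.measurable_offspring [] (measurableSet_singleton k)
  have hterm : ∀ k, (p k).toReal * (1 - (1 - s) ^ k) ≤
      P.real (N [] ⁻¹' {k} ∩ {ω | ∀ i < k, (C i ω : ℝ) < K}ᶜ) := by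
    intro k
    have hpk : P (N [] ⁻¹' {k}) = p k := by
      rw [← Measure.map_apply (h.measurable_offspring []) (measurableSet_singleton k),
        h.law_offspring, PMF.toMeasure_apply_singleton _ _ (measurableSet_singleton k)]
    rw [measureReal_def, (Indep_iff _ _ _).1 h.indep_root_children _ _
      (measurable_particleSigma_root N X (measurableSet_singleton k)) (hall k).compl,
      ENNReal.toReal_mul, hpk, ← measureReal_def, probReal_compl_eq_one_sub (hle _ (hall k))]
    gcongr
    exact h.measureReal_forall_children_lt n y K hs k
  -- The events are disjoint in `k`, and on each of them a single successful child already supplies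
  -- `K` particles.
  calc _ ≤ ∑ k ∈ Finset.range M,
        P.real (N [] ⁻¹' {k} ∩ {ω | ∀ i < k, (C i ω : ℝ) < K}ᶜ) :=
        Finset.sum_le_sum fun k _ => hterm k
    _ = P.real (⋃ k ∈ Finset.range M, N [] ⁻¹' {k} ∩ {ω | ∀ i < k, (C i ω : ℝ) < K}ᶜ) := by
        rw [measureReal_biUnion_finset]
        · intro k _ l _ hkl
          refine Set.disjoint_left.2 ?_
          rintro ω ⟨hk, -⟩ ⟨hl, -⟩
          exact hkl (hk.symm.trans hl)
        · exact fun k _ => (hroot k).inter (hle _ (hall k)).compl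
    _ ≤ _ := by
        refine measureReal_mono fun ω hω => ?_
        simp only [Set.mem_iUnion] at hω
        obtain ⟨k, -, hk, hω⟩ := hω
        simp only [Set.mem_compl_iff, Set.mem_ofPred_eq, not_forall, not_lt] at hω
        obtain ⟨i, hi, hK⟩ := hω
        refine hK.trans ?_
        rw [count_succ_root]
        refine Nat.cast_le.2 (Finset.single_le_sum (f := fun i => C i ω)
          (fun _ _ => Nat.zero_le _) ?_)
        rw [Finset.mem_range]
        exact hi.trans_eq hk.symm

end BRW

/-! ### Propagation of lower bounds for the tail probabilities -/

namespace BRW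

variable {Ω : Type*} [MeasurableSpace Ω] {P : Measure Ω} {p : PMF ℕ} {ν : Measure ℝ}

/-- `b y` is a lower bound for `P(Z_n([y, ∞)) ≥ K`, for every branching random walk on `P` with
offspring law `p` and step law `ν`. -/
def IsTailBound (P : Measure Ω) (p : PMF ℕ) (ν : Measure ℝ) (K : ℝ) (n : ℕ) (b : ℝ → ENNReal) :
    Prop :=
  ∀ (N : List ℕ → Ω → ℕ) (X : List ℕ → Ω → ℝ), IsBranchingRandomWalk P p ν N X → ∀ y,
    b y ≤ P {ω | K ≤ (count (fun u => N u ω) (fun u => X u ω) n (Set.Ici y) : ℝ)}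

/-- A bound valid for every walk applies to the subtrees of the children. While the averaged bound
stays below `δ`, reproduction multiplies it by at least `m`. -/
lemma IsTailBound.succ [IsProbabilityMeasure P] [SFinite ν] {K : ℝ} {n : ℕ} {b : ℝ → ENNReal}
    (hb : IsTailBound P p ν K n b) {M : ℕ} {m δ : ℝ} (hm : 0 ≤ m)
    (hM : ∀ s, 0 ≤ s → s ≤ δ →
      m * s ≤ ∑ k ∈ Finset.range M, (p k).toReal * (1 - (1 - s) ^ k))
    (hδ0 : 0 ≤ δ) (hδ : ∀ y, ∫⁻ z, b (y - z) ∂ν ≤ ENNReal.ofReal δ) :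
    IsTailBound P p ν K (n + 1) fun y => ENNReal.ofReal m * ∫⁻ z, b (y - z) ∂ν := by
  intro N X h y
  set s := ∫⁻ z, b (y - z) ∂ν with hs
  have hsfin : s ≠ ⊤ := ((hδ y).trans_lt ENNReal.ofReal_lt_top).ne
  have hle : ∀ i, s ≤ P {ω | K ≤ (count (fun u => subtree N i u ω)
      (fun u => subtree X i u ω) n (Set.Ici (y - X [i] ω)) : ℝ)} := by
    intro i
    set f : ℕ → ENNReal := Set.indicator {k : ℕ | K ≤ (k : ℝ)} 1
    have hN := (h.subtree i).lintegral_count_sub_step f n y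
    have hmeas : ∀ z, MeasurableSet {ω | K ≤ (count (fun u => subtree N i u ω)
        (fun u => subtree X i u ω) n (Set.Ici (y - z)) : ℝ)} := by
      intro z
      have : Measurable fun ω => ((fun v => (subtree N i v ω, subtree X i v ω), y - z) :
          (List ℕ → ℕ × ℝ) × ℝ) :=
        (measurable_pi_iff.2 (h.subtree i).measurable_particle).prodMk measurable_const
      exact ((measurable_count n).comp this)
        (MeasurableSet.of_discrete (s := {k : ℕ | K ≤ (k : ℝ)}))
    have h1 : ∫⁻ ω, f (count (fun u => subtree N i u ω) (fun u => subtree X i u ω) n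
        (Set.Ici (y - subtree X i [] ω))) ∂P = P {ω | K ≤ (count (fun u => subtree N i u ω)
        (fun u => subtree X i u ω) n (Set.Ici (y - X [i] ω)) : ℝ)} :=
      lintegral_indicator_one (h.measurable_count_subtree i n y
        (MeasurableSet.of_discrete (s := {k : ℕ | K ≤ (k : ℝ)})))
    rw [← h1, hN]
    refine lintegral_mono fun z => (hb _ _ (h.subtree i) (y - z)).trans_eq ?_
    exact (lintegral_indicator_one (hmeas z)).symm
  have hstep := h.sum_le_measureReal_level_succ n y K (s := s.toReal)
    (fun i => ENNReal.toReal_mono (measure_ne_top _ _) (hle i)) M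
  have := (hM s.toReal ENNReal.toReal_nonneg (ENNReal.toReal_le_of_le_ofReal hδ0 (hδ y))).trans
    hstep
  calc ENNReal.ofReal m * s = ENNReal.ofReal (m * s.toReal) := by
        rw [ENNReal.ofReal_mul hm, ENNReal.ofReal_toReal hsfin]
    _ ≤ _ := ENNReal.ofReal_le_of_le_toReal this

lemma lintegral_gaussianReal_Ici_sub (j : ℕ) (y : ℝ) :
    ∫⁻ z, gaussianReal 0 j (Set.Ici (y - z)) ∂(gaussianReal 0 1) =
      gaussianReal 0 ((j + 1 : ℕ) : NNReal) (Set.Ici y) := by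
  have e := gaussianReal_conv_gaussianReal (m₁ := 0) (m₂ := 0) (v₁ := 1) (v₂ := j)
  rw [add_zero, add_comm] at e
  rw [Nat.cast_add, Nat.cast_one, ← e, ← lintegral_indicator_one measurableSet_Ici,
    Measure.lintegral_conv (measurable_one.indicator measurableSet_Ici)]
  refine lintegral_congr fun z => ?_
  rw [← lintegral_indicator_one measurableSet_Ici]
  refine lintegral_congr fun t => ?_
  simp [Set.indicator_apply, add_comm]

/-- `c` is a lower bound for `P(Z_n([y, ∞)) ≥ K` for all `y ≤ y₀`. -/
abbrev IsTailBoundUpTo (P : Measure Ω) (p : PMF ℕ) (K : ℝ) (n : ℕ) (y₀ c : ℝ) : Prop :=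
  IsTailBound P p (gaussianReal 0 1) K n fun y => if y ≤ y₀ then ENNReal.ofReal c else 0

lemma IsTailBoundUpTo.mono {K y₀ c c' : ℝ} {n : ℕ} (h : IsTailBoundUpTo P p K n y₀ c)
    (hc : c' ≤ c) : IsTailBoundUpTo P p K n y₀ c' := by
  intro N X hNX y
  refine le_trans ?_ (h N X hNX y)
  dsimp only
  split_ifs
  · exact ENNReal.ofReal_le_ofReal hc
  · exact le_rfl

/-- A step function is a Gaussian tail of variance 0, and each generation convolves it with a
standard normal and multiplies it by `m`. The factor `max 1 m` keeps all intermediate bounds below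
`δ`, whether or not `m` exceeds 1. -/
lemma IsTailBoundUpTo.iterate [IsProbabilityMeasure P] {K y₀ c : ℝ} {n : ℕ}
    (hb : IsTailBoundUpTo P p K n y₀ c) (hc : 0 ≤ c) {M : ℕ} {m δ : ℝ} (hm : 0 ≤ m)
    (hM : ∀ s, 0 ≤ s → s ≤ δ →
      m * s ≤ ∑ k ∈ Finset.range M, (p k).toReal * (1 - (1 - s) ^ k))
    {l : ℕ} (hδ : c * max 1 m ^ l ≤ δ) {j : ℕ} (hj : j ≤ l) :
    IsTailBound P p (gaussianReal 0 1) K (n + j) fun y =>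
      ENNReal.ofReal (c * m ^ j) * gaussianReal 0 j (Set.Ici (y - y₀)) := by
  have hδ0 : 0 ≤ δ := le_trans (by positivity) hδ
  induction j with
  | zero =>
    intro N X h y
    refine le_trans (le_of_eq ?_) (hb N X h y)
    dsimp only
    rw [Nat.cast_zero, gaussianReal_zero_var, Measure.dirac_apply' _ measurableSet_Ici]
    by_cases hy : y ≤ y₀ <;> simp [hy]
  | succ j ih =>
    have hint : ∀ y, ∫⁻ z, ENNReal.ofReal (c * m ^ j) *
        gaussianReal 0 j (Set.Ici (y - z - y₀)) ∂(gaussianReal 0 1) =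
        ENNReal.ofReal (c * m ^ j) *
          gaussianReal 0 ((j + 1 : ℕ) : NNReal) (Set.Ici (y - y₀)) := by
      intro y
      rw [lintegral_const_mul' _ _ ENNReal.ofReal_ne_top, ← lintegral_gaussianReal_Ici_sub]
      simp only [sub_right_comm]
    have := (ih (by omega)).succ hm hM hδ0 (fun y => by
      rw [hint]
      calc _ ≤ ENNReal.ofReal (c * m ^ j) * 1 := by gcongr; exact prob_le_one
        _ ≤ _ := by
          rw [mul_one]
          refine ENNReal.ofReal_le_ofReal (le_trans ?_ hδ)
          gcongr
          calc m ^ j ≤ max 1 m ^ j := by gcongr; exact le_max_right _ _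
            _ ≤ max 1 m ^ l := by
              gcongr
              · exact le_max_left _ _
              · omega)
    rw [← add_assoc]
    convert this using 2 with y
    rw [hint, ← mul_assoc, ← ENNReal.ofReal_mul hm]
    congr 2
    ring

/-- After `l` generations the Gaussian profile is cut back to a step function, with its value at the
new edge, so that blocks can be chained. -/
lemma IsTailBoundUpTo.block [IsProbabilityMeasure P] {K y₀ c : ℝ} {n : ℕ}
    (hb : IsTailBoundUpTo P p K n y₀ c) (hc : 0 ≤ c) {M : ℕ} {m δ : ℝ} (hm : 0 ≤ m)
    (hM : ∀ s, 0 ≤ s → s ≤ δ →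
      m * s ≤ ∑ k ∈ Finset.range M, (p k).toReal * (1 - (1 - s) ^ k))
    {l : ℕ} (hδ : c * max 1 m ^ l ≤ δ) {x ρ : ℝ}
    (hρ : ρ ≤ m ^ l * (gaussianReal 0 l).real (Set.Ici (x * l))) :
    IsTailBoundUpTo P p K (n + l) (y₀ + x * l) (c * ρ) := by
  intro N X h y
  refine le_trans ?_ (hb.iterate hc hm hM hδ le_rfl N X h y)
  dsimp only
  split_ifs with hy
  · calc ENNReal.ofReal (c * ρ)
        ≤ ENNReal.ofReal (c * m ^ l * (gaussianReal 0 l).real (Set.Ici (x * l))) := by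
          refine ENNReal.ofReal_le_ofReal ?_
          rw [mul_assoc]
          gcongr
      _ = ENNReal.ofReal (c * m ^ l) * gaussianReal 0 l (Set.Ici (x * l)) := by
          rw [ENNReal.ofReal_mul (by positivity), ofReal_measureReal]
      _ ≤ _ := by
          gcongr
          linarith
  · exact zero_le

lemma IsTailBoundUpTo.blocks [IsProbabilityMeasure P] {K y₀ c : ℝ} {n : ℕ}
    (hb : IsTailBoundUpTo P p K n y₀ c) (hc : 0 ≤ c) {M : ℕ} {m δ : ℝ} (hm : 0 ≤ m)
    (hM : ∀ s, 0 ≤ s → s ≤ δ →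
      m * s ≤ ∑ k ∈ Finset.range M, (p k).toReal * (1 - (1 - s) ^ k))
    {l r : ℕ} {x ρ : ℝ} (hδ : c * max 1 ρ ^ r * max 1 m ^ l ≤ δ) (hρ0 : 0 ≤ ρ)
    (hρ : ρ ≤ m ^ l * (gaussianReal 0 l).real (Set.Ici (x * l))) :
    IsTailBoundUpTo P p K (n + r * l) (y₀ + x * (r * l)) (c * ρ ^ r) := by
  induction r with
  | zero => simpa using hb
  | succ r ih =>
    have h1 : (1 : ℝ) ≤ max 1 ρ := le_max_left _ _
    have h2 : c * max 1 ρ ^ r * max 1 m ^ l ≤ δ := by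
      refine le_trans ?_ hδ
      gcongr
      · omega
    have h3 : c * ρ ^ r * max 1 m ^ l ≤ δ := by
      refine le_trans ?_ h2
      gcongr
      exact le_max_right _ _
    convert (ih h2).block (by positivity) hm hM h3 hρ using 1
    · ring
    · push_cast; ring
    · ring

/-- Independently of the family size, the number `G` of the first `M` children jumping beyond `x`
has mean at least `2 * K` and never exceeds `M`. A reverse Markov inequality gives `G ≥ K` with
probability at least half that of one such jump. -/
lemma isTailBound_one [IsProbabilityMeasure P] {K x : ℝ} {M : ℕ} (hK : 0 ≤ K) (hM0 : 0 < M)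
    (hM : 2 * K ≤ ν.real (Set.Ici x) * M) :
    IsTailBound P p ν K 1 fun y => if y ≤ x then
      ENNReal.ofReal (p.toMeasure.real {k | M ≤ k} * (ν.real (Set.Ici x) / 2)) else 0 := by
  intro N X h y
  dsimp only
  split_ifs with hy
  swap
  · exact zero_le
  set θ := ν.real (Set.Ici x) with hθ
  set G : Ω → ℝ := fun ω => ∑ i ∈ Finset.range M, (X [i] ⁻¹' Set.Ici x).indicator 1 ω with hG
  have hSm : ∀ i, MeasurableSet (X [i] ⁻¹' Set.Ici x) := fun i =>
    h.measurable_step [i] measurableSet_Ici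
  have hGσ : Measurable[particleSigma N X {u | u ≠ []}] G := by
    let _ : MeasurableSpace Ω := particleSigma N X {u | u ≠ []}
    refine Finset.measurable_fun_sum _ fun i _ => measurable_one.indicator ?_
    exact (measurable_particleSigma N X (S := {u | u ≠ []}) (u := [i]) (by simp)).snd
      measurableSet_Ici
  have hle : particleSigma N X {u | u ≠ []} ≤ (inferInstance : MeasurableSpace Ω) :=
    iSup₂_le fun u _ => (h.measurable_particle u).comap_le
  have hEσ : MeasurableSet[particleSigma N X {u | u ≠ []}] (G ⁻¹' Set.Ici K) :=
    hGσ measurableSet_Ici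
  have hint : ∀ i, Integrable ((X [i] ⁻¹' Set.Ici x).indicator (1 : Ω → ℝ)) P := fun i =>
    (integrable_const 1).indicator (hSm i)
  have hintE : Integrable ((G ⁻¹' Set.Ici K).indicator (1 : Ω → ℝ)) P :=
    (integrable_const 1).indicator (hle _ hEσ)
  have hmean : ∫ ω, G ω ∂P = M * θ := by
    rw [hG, integral_finsetSum _ fun i _ => hint i]
    have : ∀ i, ∫ ω, (X [i] ⁻¹' Set.Ici x).indicator (1 : Ω → ℝ) ω ∂P = θ := by
      intro i
      rw [integral_indicator_one (hSm i), hθ, ← h.law_step [i],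
        map_measureReal_apply (h.measurable_step [i]) measurableSet_Ici]
    simp [this]
  have hupper : ∫ ω, G ω ∂P ≤ K + M * P.real (G ⁻¹' Set.Ici K) := by
    calc ∫ ω, G ω ∂P ≤ ∫ ω, (K + M * (G ⁻¹' Set.Ici K).indicator 1 ω) ∂P := by
          refine integral_mono (integrable_finsetSum _ fun i _ => hint i)
            ((integrable_const K).add
              (hintE.const_mul _)) fun ω => ?_
          by_cases hω : K ≤ G ω
          · have hGM : G ω ≤ M := by
              calc G ω ≤ ∑ i ∈ Finset.range M, (1 : ℝ) :=
                    Finset.sum_le_sum fun i _ => Set.indicator_le_self' (by simp) ω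
                _ = M := by simp
            have : ω ∈ G ⁻¹' Set.Ici K := hω
            simp only [Set.indicator_of_mem this, Pi.one_apply, mul_one]
            linarith
          · have : ω ∉ G ⁻¹' Set.Ici K := hω
            simp only [Set.indicator_of_notMem this, mul_zero, add_zero]
            exact (not_le.1 hω).le
      _ = _ := by
          rw [integral_add (integrable_const K) (hintE.const_mul _), integral_const_mul,
            integral_indicator_one (hle _ hEσ)]
          simp
  have hhalf : θ / 2 ≤ P.real (G ⁻¹' Set.Ici K) := by
    have hMpos : (0 : ℝ) < M := by exact_mod_cast hM0
    rw [hmean] at hupper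
    have : (M : ℝ) * (θ / 2) ≤ M * P.real (G ⁻¹' Set.Ici K) := by linarith
    exact le_of_mul_le_mul_left this hMpos
  have hroot : P (N [] ⁻¹' {k | M ≤ k}) = p.toMeasure {k | M ≤ k} := by
    rw [← h.law_offspring [], Measure.map_apply (h.measurable_offspring [])
      MeasurableSet.of_discrete]
  calc ENNReal.ofReal (p.toMeasure.real {k | M ≤ k} * (θ / 2))
      ≤ p.toMeasure {k | M ≤ k} * P (G ⁻¹' Set.Ici K) := by
        rw [ENNReal.ofReal_mul measureReal_nonneg, ofReal_measureReal]
        gcongr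
        exact ENNReal.ofReal_le_of_le_toReal hhalf
    _ = P (N [] ⁻¹' {k | M ≤ k} ∩ G ⁻¹' Set.Ici K) := by
        rw [(Indep_iff _ _ _).1 h.indep_root_children _ _
          (measurable_particleSigma_root N X MeasurableSet.of_discrete) hEσ, hroot]
    _ ≤ _ := by
        refine measure_mono ?_
        rintro ω ⟨hk, hKG⟩
        refine le_trans (b := G ω) hKG ?_
        rw [count_succ_root, Nat.cast_sum]
        calc G ω ≤ ∑ i ∈ Finset.range (N [] ω), (X [i] ⁻¹' Set.Ici x).indicator 1 ω :=
              Finset.sum_le_sum_of_subset_of_nonneg (Finset.range_mono hk)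
                fun i _ _ => Set.indicator_nonneg (by simp) ω
          _ ≤ _ := by
            refine Finset.sum_le_sum fun i _ => ?_
            classical
            rw [count_zero, Set.indicator_apply]
            by_cases hi : x ≤ X [i] ω
            · simp [hi, hy.trans hi]
            · simp only [Set.mem_preimage, Set.mem_Ici, hi, if_false]
              positivity

end BRW

namespace BRW

/-! ### The offspring law -/

lemma integrable_natCast_of_tail {p : PMF ℕ} {β : ℝ} (hβ : 1 < β)
    (htail : (fun y : ℝ => p.toMeasure.real {k : ℕ | y < (k : ℝ)})
      =O[atTop] fun y : ℝ => y ^ (-β)) :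
    Integrable (fun k : ℕ => (k : ℝ)) p.toMeasure := by
  refine (lintegral_ofReal_ne_top_iff_integrable
    measurable_from_nat.aestronglyMeasurable (ae_of_all _ fun k => Nat.cast_nonneg k)).1 ?_
  have hsum : Summable fun i : ℕ => p.toMeasure.real {k : ℕ | (i : ℝ) < (k : ℝ)} :=
    summable_of_isBigO_nat (Real.summable_nat_rpow.2 (by linarith : -β < -1))
      (htail.comp_tendsto tendsto_natCast_atTop_atTop)
  have : ∫⁻ k : ℕ, ENNReal.ofReal (k : ℝ) ∂p.toMeasure =
      ∑' i : ℕ, ENNReal.ofReal (p.toMeasure.real {k : ℕ | (i : ℝ) < (k : ℝ)}) := by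
    simp only [ENNReal.ofReal_natCast, natCast_eq_tsum_ite]
    rw [lintegral_tsum fun i => measurable_from_nat.aemeasurable]
    refine tsum_congr fun i => ?_
    rw [ofReal_measureReal, ← lintegral_indicator_one MeasurableSet.of_discrete]
    refine lintegral_congr fun k => ?_
    simp [Set.indicator_apply]
  rw [this]
  exact hsum.tsum_ofReal_ne_top

lemma ofReal_offspringMean {p : PMF ℕ}
    (hint : Integrable (fun k : ℕ => (k : ℝ)) p.toMeasure) :
    ENNReal.ofReal (offspringMean p) = ∫⁻ k, (k : ENNReal) ∂p.toMeasure := by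
  rw [offspringMean, ofReal_integral_eq_lintegral_ofReal hint
    (ae_of_all _ fun k => Nat.cast_nonneg k)]
  simp

lemma offspringMean_eq_tsum {p : PMF ℕ}
    (hint : Integrable (fun k : ℕ => (k : ℝ)) p.toMeasure) :
    offspringMean p = ∑' k : ℕ, (p k).toReal * k := by
  simpa [offspringMean] using p.integral_eq_tsum _ hint

lemma offspringMean_pos {p : PMF ℕ} (hp0 : p 0 = 0)
    (hint : Integrable (fun k : ℕ => (k : ℝ)) p.toMeasure) : 0 < offspringMean p := by
  refine (integral_pos_iff_support_of_nonneg (fun k => Nat.cast_nonneg k) hint).2 ?_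
  have : Function.support (fun k : ℕ => (k : ℝ)) = {0}ᶜ := by
    ext k; simp
  rw [this, prob_compl_eq_one_sub (measurableSet_singleton 0),
    PMF.toMeasure_apply_singleton _ _ (measurableSet_singleton 0), hp0]
  simp

lemma one_sub_pow_le {s : ℝ} (h0 : 0 ≤ s) (h1 : s ≤ 1) (k : ℕ) :
    (1 - s) ^ k ≤ 1 - k * s + (k * s) ^ 2 := by
  induction k with
  | zero => simp
  | succ k ih =>
    have hk : (0 : ℝ) ≤ k := Nat.cast_nonneg k
    calc (1 - s) ^ (k + 1) = (1 - s) ^ k * (1 - s) := pow_succ _ _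
      _ ≤ (1 - k * s + (k * s) ^ 2) * (1 - s) :=
        mul_le_mul_of_nonneg_right ih (by linarith)
      _ ≤ _ := by
        push_cast
        have : 0 ≤ s ^ 2 * (k + 1 + k ^ 2 * s) := by positivity
        nlinarith

/-- The offspring variance may be infinite, so the law is first truncated at `M`, keeping a mean
above `m`. The quadratic error of the expansion is then finite and absorbed by the surplus `A - m`
for small `s`. -/
lemma exists_linear_lower_bound {p : PMF ℕ}
    (hint : Integrable (fun k : ℕ => (k : ℝ)) p.toMeasure) {m : ℝ} (hm0 : 0 ≤ m)
    (hm : m < offspringMean p) :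
    ∃ (M : ℕ) (δ : ℝ), 0 < δ ∧ ∀ s, 0 ≤ s → s ≤ δ →
      m * s ≤ ∑ k ∈ Finset.range M, (p k).toReal * (1 - (1 - s) ^ k) := by
  rw [offspringMean_eq_tsum hint] at hm
  have hsum : Summable fun k : ℕ => (p k).toReal * k := by
    by_contra h
    rw [tsum_eq_zero_of_not_summable h] at hm
    linarith
  obtain ⟨M, hM⟩ := (hsum.hasSum.tendsto_sum_nat.eventually (lt_mem_nhds hm)).exists
  set A := ∑ k ∈ Finset.range M, (p k).toReal * k
  set B := ∑ k ∈ Finset.range M, (p k).toReal * (k : ℝ) ^ 2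
  have hB : 0 ≤ B := Finset.sum_nonneg fun k _ => by positivity
  refine ⟨M, min 1 ((A - m) / (B + 1)), lt_min one_pos (div_pos (sub_pos.2 hM) (by positivity)),
    fun s h0 hs => ?_⟩
  have h1 : s ≤ 1 := hs.trans (min_le_left _ _)
  have h2 : s * (B + 1) ≤ A - m := (le_div_iff₀ (by positivity)).1 (hs.trans (min_le_right _ _))
  calc m * s ≤ A * s - B * s ^ 2 := by nlinarith [mul_nonneg h0 h0, mul_le_mul_of_nonneg_left h2 h0]
    _ = ∑ k ∈ Finset.range M, (p k).toReal * (k * s - (k * s) ^ 2) := by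
      rw [Finset.sum_mul, Finset.sum_mul, ← Finset.sum_sub_distrib]
      exact Finset.sum_congr rfl fun k _ => by ring
    _ ≤ _ := Finset.sum_le_sum fun k _ =>
      mul_le_mul_of_nonneg_left (by linarith [one_sub_pow_le h0 h1 k]) ENNReal.toReal_nonneg

lemma exists_exp_le_tail {p : PMF ℕ} {β : ℝ}
    (htail : (fun y : ℝ => y ^ (-β)) =O[atTop]
      fun y : ℝ => p.toMeasure.real {k : ℕ | y < (k : ℝ)})
    {a b : ℝ} (ha : 0 < a) (hb : 0 < b) :
    ∃ c > 0, ∀ᶠ n : ℕ in atTop, c * Real.exp (-(β * a * n)) ≤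
      p.toMeasure.real {k | ⌈b * Real.exp (a * n)⌉₊ ≤ k} := by
  obtain ⟨D, hD, hbound⟩ := htail.exists_pos
  have hlim : Tendsto (fun n : ℕ => b * Real.exp (a * n)) atTop atTop :=
    (Real.tendsto_exp_atTop.comp
      (tendsto_natCast_atTop_atTop.const_mul_atTop ha)).const_mul_atTop hb
  refine ⟨D⁻¹ * b ^ (-β), by positivity, ?_⟩
  filter_upwards [hlim.eventually hbound.bound] with n hn
  rw [Real.norm_of_nonneg (by positivity), Real.norm_of_nonneg measureReal_nonneg,
    Real.mul_rpow hb.le (Real.exp_pos _).le, ← Real.exp_mul] at hn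
  calc D⁻¹ * b ^ (-β) * Real.exp (-(β * a * n))
      = D⁻¹ * (b ^ (-β) * Real.exp (a * n * -β)) := by
        rw [mul_assoc]; congr 3; ring
    _ ≤ p.toMeasure.real {k : ℕ | b * Real.exp (a * n) < (k : ℝ)} := (inv_mul_le_iff₀ hD).2 hn
    _ ≤ _ := measureReal_mono fun k hk => Nat.ceil_le.2 (Set.mem_ofPred_eq.mp hk).le

/-! ### Gaussian tails -/

lemma le_gaussianReal_Ici {x : ℝ} (hx : 0 < x) {l : ℕ} (hl : 0 < l) :
    (√(2 * Real.pi * l))⁻¹ * Real.exp (-(x * l + 1) ^ 2 / (2 * l)) ≤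
      (gaussianReal 0 l).real (Set.Ici (x * l)) := by
  set c := (√(2 * Real.pi * l))⁻¹ * Real.exp (-(x * l + 1) ^ 2 / (2 * l))
  have hl' : (0 : ℝ) < l := by exact_mod_cast hl
  have hxl : 0 < x * l := by positivity
  rw [measureReal_def]
  refine (ENNReal.ofReal_le_iff_le_toReal (measure_ne_top _ _)).1 ?_
  rw [gaussianReal_apply 0 (by exact_mod_cast hl.ne')]
  calc ENNReal.ofReal c = ∫⁻ _ in Set.Icc (x * l) (x * l + 1), ENNReal.ofReal c := by simp
    _ ≤ ∫⁻ z in Set.Icc (x * l) (x * l + 1), gaussianPDF 0 l z := by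
      refine setLIntegral_mono (measurable_gaussianPDF _ _) fun z hz => ?_
      rw [gaussianPDF, gaussianPDFReal]
      refine ENNReal.ofReal_le_ofReal ?_
      simp only [NNReal.coe_natCast, sub_zero, c]
      gcongr
      · exact hxl.le.trans hz.1
      · exact hz.2
    _ ≤ _ := lintegral_mono_set fun z hz => hz.1

lemma gaussianReal_Ici_pos {x : ℝ} (hx : 0 < x) : 0 < (gaussianReal 0 1).real (Set.Ici x) := by
  have := le_gaussianReal_Ici hx one_pos
  simp only [Nat.cast_one, mul_one] at this
  exact lt_of_lt_of_le (by positivity) this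

lemma exists_exp_le_gaussianReal_Ici {x η : ℝ} (hx : 0 < x) (hη : 0 < η) :
    ∃ l : ℕ, 0 < l ∧ Real.exp (-((x ^ 2 / 2 + η) * l)) ≤
      (gaussianReal 0 l).real (Set.Ici (x * l)) := by
  -- The unit interval beyond `x * l` costs at most `exp (x + 1 / 2)` in the exponential and `2 * π
  -- * l` in the normalisation, in all `D * l`. The choice of `l` makes `(η * l) ^ 2 / 2`, hence
  -- `exp (η * l)`, exceed it.
  set D := 2 * Real.pi * Real.exp (x + 1 / 2)
  obtain ⟨l, hl⟩ := exists_nat_ge (2 * D / η ^ 2 + 1)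
  have hD : 0 < D := by positivity
  have hl1 : (1 : ℝ) ≤ l := le_trans (by linarith [show 0 ≤ 2 * D / η ^ 2 by positivity]) hl
  have hl0 : 0 < l := by exact_mod_cast (one_pos.trans_le hl1)
  refine ⟨l, hl0, le_trans ?_ (le_gaussianReal_Ici hx hl0)⟩
  have hpos : (0 : ℝ) < l := by exact_mod_cast hl0
  have hDl : D * l ≤ Real.exp (η * l) := by
    have h1 : 2 * D ≤ l * η ^ 2 := (div_le_iff₀ (by positivity)).1 (by linarith)
    have h2 := Real.quadratic_le_exp_of_nonneg (x := η * l) (by positivity)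
    have h3 : 0 < η * l := by positivity
    nlinarith
  have hsqrt : √(2 * Real.pi * l) ≤ 2 * Real.pi * l := by
    rw [Real.sqrt_le_left (by positivity)]
    have : 1 ≤ 2 * Real.pi * l := by nlinarith [Real.pi_gt_three]
    nlinarith
  have hexp : -(x ^ 2 / 2 * l) - (x + 1 / 2) ≤ -(x * l + 1) ^ 2 / (2 * l) := by
    rw [le_div_iff₀ (by positivity)]
    nlinarith
  calc Real.exp (-((x ^ 2 / 2 + η) * l))
      = Real.exp (-(x ^ 2 / 2 * l) - (x + 1 / 2)) * (Real.exp (x + 1 / 2) / Real.exp (η * l)) := by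
        rw [← Real.exp_sub, ← Real.exp_add]; congr 1; ring
    _ ≤ Real.exp (-(x * l + 1) ^ 2 / (2 * l)) * (√(2 * Real.pi * l))⁻¹ := by
        gcongr
        rw [div_le_iff₀ (Real.exp_pos _), ← div_eq_inv_mul, le_div_iff₀ (by positivity)]
        calc _ ≤ Real.exp (x + 1 / 2) * (2 * Real.pi * l) := by gcongr
          _ = D * l := by ring
          _ ≤ _ := hDl
    _ = _ := mul_comm _ _

lemma lintegral_exp_mul_gaussianReal (x : ℝ) :
    ∫⁻ z, ENNReal.ofReal (Real.exp (x * z)) ∂(gaussianReal 0 1) =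
      ENNReal.ofReal (Real.exp (x ^ 2 / 2)) := by
  rw [← ofReal_integral_eq_lintegral_ofReal (integrable_exp_mul_gaussianReal x)
    (ae_of_all _ fun _ => (Real.exp_pos _).le)]
  have := congrFun (mgf_id_gaussianReal (μ := 0) (v := 1)) x
  simp only [mgf, id, zero_mul, zero_add, NNReal.coe_one, one_mul] at this
  rw [this]

end BRW

/-! ### The two exponential estimates and their logarithmic limits -/

namespace BRW

variable {Ω : Type*} [MeasurableSpace Ω] {P : Measure Ω} {p : PMF ℕ}
  {N : List ℕ → Ω → ℕ} {X : List ℕ → Ω → ℝ}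

lemma levelProb_le [IsProbabilityMeasure P]
    (h : IsBranchingRandomWalk P p (gaussianReal 0 1) N X) (hp0 : p 0 = 0)
    (hint : Integrable (fun k : ℕ => (k : ℝ)) p.toMeasure) {x : ℝ} (hx : 0 ≤ x) (a : ℝ) (n : ℕ) :
    levelProb P N X x a n ≤ ENNReal.ofReal
      (Real.exp (-(a - (Real.log (offspringMean p) - x ^ 2 / 2)) * n)) := by
  have hm := offspringMean_pos hp0 hint
  have hmean := h.lintegral_count_le hx (lintegral_exp_mul_gaussianReal x).le n (x * n)
  rw [← ofReal_offspringMean hint, ← ENNReal.ofReal_mul hm.le,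
    ← ENNReal.ofReal_pow (by positivity), ← ENNReal.ofReal_mul (by positivity)] at hmean
  have hmarkov := mul_meas_ge_le_lintegral₀ (μ := P)
    (f := fun ω => (count (fun u => N u ω) (fun u => X u ω) n (Set.Ici (x * n)) : ENNReal))
    (measurable_from_nat.comp ((measurable_count n).comp
      ((measurable_pi_iff.2 h.measurable_particle).prodMk measurable_const))).aemeasurable
    (ENNReal.ofReal (Real.exp (a * n)))
  have hset : levelProb P N X x a n = P {ω | ENNReal.ofReal (Real.exp (a * n)) ≤
      (count (fun u => N u ω) (fun u => X u ω) n (Set.Ici (x * n)) : ENNReal)} := by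
    rw [levelProb]
    congr 1
    ext ω
    simp only [Set.mem_ofPred_eq]
    rw [← ENNReal.ofReal_natCast, ENNReal.ofReal_le_ofReal_iff (Nat.cast_nonneg _)]
  rw [hset]
  have he : ENNReal.ofReal (Real.exp (a * n)) ≠ 0 := by simp [Real.exp_pos]
  refine (ENNReal.mul_le_mul_iff_right he ENNReal.ofReal_ne_top).1
    ((hmarkov.trans hmean).trans_eq ?_)
  rw [← ENNReal.ofReal_mul (Real.exp_pos _).le]
  congr 1
  nth_rw 1 [← Real.exp_log hm]
  rw [← Real.exp_add, ← Real.exp_nat_mul, ← Real.exp_add, ← Real.exp_add]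
  congr 1
  ring

lemma exists_exp_le_levelProb [IsProbabilityMeasure P]
    (h : IsBranchingRandomWalk P p (gaussianReal 0 1) N X) (hp0 : p 0 = 0) {β : ℝ} (hβ : 1 < β)
    (hint : Integrable (fun k : ℕ => (k : ℝ)) p.toMeasure)
    (htail : (fun y : ℝ => y ^ (-β)) =O[atTop]
      fun y : ℝ => p.toMeasure.real {k : ℕ | y < (k : ℝ)})
    {x a : ℝ} (hx : 0 < x) (ha : max (Real.log (offspringMean p) - x ^ 2 / 2) 0 < a)
    {ε : ℝ} (hε : 0 < ε) :
    ∃ c > 0, ∀ᶠ n : ℕ in atTop, ENNReal.ofReal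
      (c * Real.exp ((Real.log (offspringMean p) - x ^ 2 / 2 - ε - β * a) * n)) ≤
        levelProb P N X x a n := by
  have hm := offspringMean_pos hp0 hint
  set μ := offspringMean p
  set lam := Real.log μ - x ^ 2 / 2 - ε with hlam
  have ha0 : 0 < a := (le_max_right _ _).trans_lt ha
  -- The margin that keeps the propagated bounds below `δ` for large `n`.
  have hlama : max 0 lam < β * a := by
    have h1 : lam < a := by linarith [(le_max_left _ _).trans_lt ha]
    exact max_lt (by positivity) (h1.trans (by nlinarith))
  -- the reproduction mean of a truncated offspring law
  set m := μ * Real.exp (-(ε / 2)) with hmdef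
  have hm0 : 0 < m := by positivity
  have hmμ : m < μ := by
    rw [hmdef]
    exact mul_lt_of_lt_one_right hm (Real.exp_lt_one_iff.2 (by linarith))
  obtain ⟨M, δ, hδ, hM⟩ := exists_linear_lower_bound hint hm0.le hmμ
  -- The loss `ε` is shared equally by the reproduction mean and the Gaussian tail.
  obtain ⟨l, hl0, hl⟩ := exists_exp_le_gaussianReal_Ici hx (half_pos hε)
  set θ := (gaussianReal 0 1).real (Set.Ici x) with hθ
  have hθ0 : 0 < θ := gaussianReal_Ici_pos hx
  have hρ : Real.exp (lam * l) ≤ m ^ l * (gaussianReal 0 l).real (Set.Ici (x * l)) := by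
    refine le_trans (le_of_eq ?_) (mul_le_mul_of_nonneg_left hl (by positivity))
    rw [hmdef, ← Real.exp_log hm, ← Real.exp_add, ← Real.exp_nat_mul, ← Real.exp_add,
      hlam]
    congr 1
    ring
  -- `m * θ` is the gain of a block of length one; capping it at 1 makes the leftover generations
  -- harmless for the smallness condition.
  set κ := min 1 (m * θ) with hκ
  have hκ0 : 0 < κ := lt_min one_pos (by positivity)
  have hκ1 : κ ≤ 1 := min_le_left _ _
  obtain ⟨c, hc, hcn⟩ := exists_exp_le_tail htail ha0 (div_pos two_pos hθ0)
  set c₀ := c * (θ / 2)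
  have hc₀ : 0 < c₀ := by positivity
  -- `κ ^ l` pays for the fewer than `l` leftover single steps; the exponential pays for the first
  -- generation and those steps, which gain no `lam`.
  refine ⟨c₀ * κ ^ l * Real.exp (-|lam| * l), by positivity, ?_⟩
  have hsmall : Tendsto (fun n : ℕ => c₀ * Real.exp (-((β * a - max 0 lam) * n)) * max 1 m ^ l)
      atTop (nhds (c₀ * 0 * max 1 m ^ l)) := by
    refine (Tendsto.const_mul _ (Real.tendsto_exp_neg_atTop_nhds_zero.comp ?_)).mul_const _
    exact tendsto_natCast_atTop_atTop.const_mul_atTop (sub_pos.2 hlama)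
  rw [mul_zero, zero_mul] at hsmall
  filter_upwards [hcn, hsmall.eventually (gt_mem_nhds hδ), eventually_ge_atTop 1] with n hn hs hn1
  set q := c₀ * Real.exp (-(β * a * n))
  have hq0 : 0 < q := by positivity
  have hbase : IsTailBoundUpTo P p (Real.exp (a * n)) 1 x q := by
    refine IsTailBoundUpTo.mono (isTailBound_one (ν := gaussianReal 0 1)
      (M := ⌈2 / θ * Real.exp (a * n)⌉₊) (Real.exp_pos _).le (Nat.ceil_pos.2 (by positivity)) ?_) ?_
    · calc 2 * Real.exp (a * n) = θ * (2 / θ * Real.exp (a * n)) := by field_simp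
        _ ≤ _ := mul_le_mul_of_nonneg_left (Nat.le_ceil _) hθ0.le
    · calc q = c * Real.exp (-(β * a * n)) * (θ / 2) := by ring
        _ ≤ _ := by gcongr
  obtain ⟨j, r, hjl, hjr⟩ : ∃ j r, j < l ∧ n = 1 + j * 1 + r * l :=
    ⟨(n - 1) % l, (n - 1) / l, Nat.mod_lt _ hl0, by
      have := Nat.mod_add_div' (n - 1) l; omega⟩
  have hlr : (l : ℝ) * r ≤ n := by
    rw [hjr]; push_cast; nlinarith [Nat.cast_nonneg (α := ℝ) j]
  have hm1 : 1 ≤ max 1 m := le_max_left _ _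
  have hgrow : max 1 (Real.exp (lam * l)) ^ r ≤ Real.exp (max 0 lam * n) := by
    have : max 1 (Real.exp (lam * l)) ≤ Real.exp (max 0 lam * l) := by
      refine max_le (Real.one_le_exp (by positivity)) ?_
      gcongr
      exact le_max_right _ _
    calc _ ≤ Real.exp (max 0 lam * l) ^ r := by gcongr
      _ = Real.exp (max 0 lam * (l * r)) := by rw [← Real.exp_nat_mul]; congr 1; ring
      _ ≤ _ := by gcongr
  have hqδ : q * Real.exp (max 0 lam * n) * max 1 m ^ l ≤ δ := by
    refine le_trans (le_of_eq ?_) hs.le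
    rw [mul_assoc c₀, ← Real.exp_add]
    congr 3
    ring
  have hqm : q * max 1 m ^ l ≤ δ := by
    refine le_trans ?_ hqδ
    gcongr
    exact le_mul_of_one_le_right hq0.le (Real.one_le_exp (by positivity))
  have hsingle : IsTailBoundUpTo P p (Real.exp (a * n)) (1 + j * 1) (x + x * (j * (1 : ℕ)))
      (q * κ ^ j) := by
    refine hbase.blocks hq0.le hm0.le hM ?_ hκ0.le ?_
    · rw [max_eq_left hκ1, one_pow, mul_one]
      refine le_trans ?_ hqm
      gcongr
      exact hl0
    · rw [pow_one, Nat.cast_one, Nat.cast_one, mul_one]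
      exact min_le_right _ _
  have hall := hsingle.blocks (by positivity) hm0.le hM (l := l) (r := r) (x := x)
    (ρ := Real.exp (lam * l)) (by
      refine le_trans ?_ hqδ
      gcongr
      exact mul_le_of_le_one_right hq0.le (pow_le_one₀ hκ0.le hκ1)) (Real.exp_pos _).le hρ
  rw [← hjr] at hall
  have hbound := hall N X h (x * n)
  have hpos : x * n ≤ x + x * (j * (1 : ℕ)) + x * (r * l) := by
    rw [hjr]; push_cast; linarith
  simp only [if_pos hpos] at hbound
  refine le_trans (ENNReal.ofReal_le_ofReal ?_) hbound
  have hexp : lam * n + -|lam| * l ≤ lam * l * r := by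
    have e : (n : ℝ) - l * r = 1 + j := by rw [hjr]; push_cast; ring
    have hj1 : (1 : ℝ) + j ≤ l := by exact_mod_cast (by omega : 1 + j ≤ l)
    have : lam * (1 + j) ≤ |lam| * l :=
      mul_le_mul (le_abs_self _) hj1 (by positivity) (abs_nonneg _)
    rw [← e] at this
    linarith
  calc c₀ * κ ^ l * Real.exp (-|lam| * l) * Real.exp ((lam - β * a) * n)
      = q * κ ^ l * Real.exp (lam * n + -|lam| * l) := by
        rw [show (lam - β * a) * n = -(β * a * n) + lam * n by ring, Real.exp_add, Real.exp_add]
        ring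
    _ ≤ q * κ ^ j * Real.exp (lam * l * r) := by
        gcongr ?_ * ?_ * ?_
        · exact pow_le_pow_of_le_one hκ0.le hκ1 hjl.le
        · gcongr
    _ = _ := by rw [← Real.exp_nat_mul, mul_comm (r : ℝ)]

lemma le_liminf_logRate {x a τ c : ℝ} (hc : 0 < c)
    (h : ∀ᶠ n : ℕ in atTop, ENNReal.ofReal (c * Real.exp (τ * n)) ≤ levelProb P N X x a n) :
    (τ : EReal) ≤ liminf (logRate P N X x a) atTop := by
  have hlim : Tendsto (fun n : ℕ => 1 / (n : ℝ) * Real.log c + τ) atTop (nhds τ) := by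
    simpa using (tendsto_one_div_atTop_nhds_zero_nat.mul_const (Real.log c)).add_const τ
  rw [← (EReal.tendsto_coe.2 hlim).liminf_eq]
  refine liminf_le_liminf ?_
  filter_upwards [h, eventually_gt_atTop 0] with n hn hn0
  have hn' : (0 : ℝ) < n := by exact_mod_cast hn0
  rw [logRate]
  calc ((1 / (n : ℝ) * Real.log c + τ : ℝ) : EReal)
      = ((1 / (n : ℝ) : ℝ) : EReal) * ENNReal.log (ENNReal.ofReal (c * Real.exp (τ * n))) := by
        rw [ENNReal.log_ofReal_of_pos (by positivity), Real.log_mul hc.ne' (Real.exp_pos _).ne',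
          Real.log_exp, ← EReal.coe_mul]
        congr 1
        field_simp
    _ ≤ _ := mul_le_mul_of_nonneg_left (ENNReal.log_monotone hn)
        (EReal.coe_nonneg.2 (by positivity))

lemma limsup_logRate_le {x a τ : ℝ}
    (h : ∀ n : ℕ, levelProb P N X x a n ≤ ENNReal.ofReal (Real.exp (τ * n))) :
    limsup (logRate P N X x a) atTop ≤ (τ : EReal) := by
  refine limsup_le_of_le (by isBoundedDefault) ?_
  filter_upwards [eventually_gt_atTop 0] with n hn0
  have hn' : (0 : ℝ) < n := by exact_mod_cast hn0
  rw [logRate]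
  calc _ ≤ ((1 / (n : ℝ) : ℝ) : EReal) * ENNReal.log (ENNReal.ofReal (Real.exp (τ * n))) :=
        mul_le_mul_of_nonneg_left (ENNReal.log_monotone (h n))
          (EReal.coe_nonneg.2 (by positivity))
    _ = _ := by
        rw [ENNReal.log_ofReal_of_pos (by positivity), Real.log_exp, ← EReal.coe_mul]
        congr 1
        field_simp

end BRW


theorem theorem4 {Ω : Type*} [MeasurableSpace Ω] (P : Measure Ω) [IsProbabilityMeasure P]
    (p : PMF ℕ) (N : List ℕ → Ω → ℕ) (X : List ℕ → Ω → ℝ)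
    (hBRW : BRW.IsBranchingRandomWalk P p (gaussianReal 0 1) N X)
    (hp0 : p 0 = 0) (β : ℝ) (hβ : 1 < β)
    (htail : (fun y : ℝ => p.toMeasure.real {k : ℕ | y < (k : ℝ)})
      =Θ[atTop] fun y : ℝ => y ^ (-β))
    (x a : ℝ) (hx : 0 < x)
    (ha : max (Real.log (BRW.offspringMean p) - x ^ 2 / 2) 0 < a) :
    ((-((β - 1) * a + a - (Real.log (BRW.offspringMean p) - x ^ 2 / 2)) : ℝ) : EReal)
        ≤ liminf (BRW.logRate P N X x a) atTop ∧
      liminf (BRW.logRate P N X x a) atTop ≤ limsup (BRW.logRate P N X x a) atTop ∧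
      limsup (BRW.logRate P N X x a) atTop
        ≤ ((-(a - (Real.log (BRW.offspringMean p) - x ^ 2 / 2)) : ℝ) : EReal) := by

  have hint := BRW.integrable_natCast_of_tail hβ htail.1
  refine ⟨?_, liminf_le_limsup, BRW.limsup_logRate_le fun n =>
    BRW.levelProb_le hBRW hp0 hint hx.le a n⟩
  -- The gap between the target and a smaller real `z` serves as `ε`.
  refine EReal.ge_of_forall_gt_iff_ge.1 fun z hz => ?_
  have hz' := sub_pos.2 (EReal.coe_lt_coe_iff.1 hz)
  obtain ⟨c, hc, hcn⟩ := BRW.exists_exp_le_levelProb hBRW hp0 hβ hint htail.2 hx ha hz'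
  refine BRW.le_liminf_logRate hc ?_
  convert hcn using 6
  ring
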